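/- Let $D$ be a division ring with center $F$. Call $D$ strongly algebraic over $F$ if every element of $D$ is algebraic over $F$ and $D$ contains a maximal subfield $K$ (a maximal element, under inclusion, of the set of commutative division subrings of $D$) together with a subset $S\subseteq K$ such that (i) $K=F(S)$, the division subring of $D$ generated by $F\cup S$, and (ii) for each $x\in D$ there are at most finitely many $y\in S$ with $xy\ne yx$. Suppose that $D$ is strongly algebraic over its center $F$, and let $N$ be a subnormal subgroup of the multiplicative group $D^*=D\setminus\{0\}$. If $N$ is finitely generated, then $N$ is central, i.e. $N\subseteq F$. -/

import Mathlib

/-- A (commutative) subfield of the division ring `D`. In Mathlib `Subfield D` is the type of division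
subrings of `D`; for non-commutative `D` these need not be commutative. -/
def IsCommutativeSubfield {D : Type*} [DivisionRing D] (K : Subfield D) : Prop :=
  ∀ x ∈ K, ∀ y ∈ K, x * y = y * x

/-- A maximal subfield of the division ring `D`: a commutative division subring that is maximal, with
respect to inclusion, among the commutative division subrings. -/
def IsMaximalSubfield {D : Type*} [DivisionRing D] (K : Subfield D) : Prop :=
  Maximal (fun L : Subfield D => IsCommutativeSubfield L) K

/-- `D` is strongly algebraic over its center `F`: it is algebraic over `F`, and it has a maximal
subfield `K` with a subset `S` such that `K = F(S)` and every `x` in `D` commutes with all but finitely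
many elements of `S`. Here `F(S)` is the division subring of `D` generated by `F ∪ S`. -/
structure IsStronglyAlgebraic (D : Type*) [DivisionRing D] : Prop where
  algebraic : Algebra.IsAlgebraic (Subring.center D) D
  exists_maximalSubfield : ∃ K : Subfield D, IsMaximalSubfield K ∧
    ∃ S : Set D, S ⊆ K ∧ K = Subfield.closure ((Subring.center D : Set D) ∪ S) ∧
      ∀ x : D, {y ∈ S | x * y ≠ y * x}.Finite

open Module
open scoped commutatorElement

/-! Given `b` in `D`, all but finitely many elements of `S` commute with `b` and with the generators
of `N`. The centralizer `E` of this cofinite part `T` contains `b`, `N` and `K`. Adjoining the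
finitely many algebraic elements of `S \ T` to the center of `E` gives a finite-dimensional
self-centralizing subalgebra, so `E` is finite-dimensional over its center
(`IsMaximalSubfield.finite_center_centralizer`). This reduces the theorem to finite-dimensional
division algebras.

There, `N` is first shown to be commutative. Inside the division algebra that `N` spans, a basis
taken from `N` defines an order over a valuation ring `V` dominating a finitely generated ring with
finite residue field. The order contains `N`, and climbing the subnormal chain shows that all units
normalize it. Its primitive elements are then invertible, so it reduces to a finite domain, which is
commutative by Wedderburn; a nonzero commutator would survive the reduction
(`mul_comm_of_fg_isSubnormal_of_span_eq_top`).

A commutative subnormal group is central: iterated commutators with `a ∈ N` vanish, and evaluating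
them on `1 + π b` modulo `π ^ 2` makes `1 - Ad a` nilpotent. A trace argument in characteristic
zero, and the absence of nontrivial `p`-power roots of unity in characteristic `p`, finish
(`Subgroup.IsSubnormal.commute_of_commutative`). -/

/-! ### Valuation rings dominating finitely generated rings with finite residue field. -/

theorem Int.isJacobsonRing : IsJacobsonRing ℤ := by
  rw [isJacobsonRing_iff_prime_eq]
  intro P hP
  by_cases h : P = ⊥
  · subst h
    rw [eq_bot_iff]
    intro n hn
    rw [Ideal.mem_jacobson_bot] at hn
    have := hn n
    rw [Int.isUnit_iff] at this
    have : n = 0 := by rcases this with h | h <;> nlinarith [mul_self_nonneg n]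
    simp [this]
  · have := hP.isMaximal h
    exact Ideal.jacobson_eq_self_of_isMaximal

theorem IsField.finite_of_finiteType_int (K : Type*) [CommRing K] (hK : IsField K)
    [alg : Algebra ℤ K] [Algebra.FiniteType ℤ K] : Finite K := by
  obtain rfl : alg = Ring.toIntAlgebra K := Subsingleton.elim _ _
  have := Int.isJacobsonRing
  let _ : Field K := hK.toField
  have hfin : Module.Finite ℤ K := finite_of_finite_type_of_isJacobsonRing ℤ K
  obtain ⟨p, hp⟩ := CharP.exists K
  -- In characteristic zero the field `K` would be integral over `ℤ`, forcing `ℤ` to be a field.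
  have hp0 : p ≠ 0 := by
    rintro rfl
    have : CharZero K := CharP.charP_to_charZero K
    have hinj : Function.Injective (algebraMap ℤ K) := by
      simpa using Int.cast_injective (α := K)
    exact Int.not_isField
      (isField_of_isIntegral_of_isField hinj hK)
  refine Module.finite_of_fg_torsion K fun x ↦ ?_
  refine ⟨⟨p, mem_nonZeroDivisors_of_ne_zero (by exact_mod_cast hp0)⟩, ?_⟩
  simp [Submonoid.smul_def]

theorem Subring.finiteType_int_closure {F : Type*} [CommRing F] {X : Set F} (hX : X.Finite) :
    Algebra.FiniteType ℤ (Subring.closure X) := by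
  have h := (Subalgebra.fg_iff_finiteType (Algebra.adjoin ℤ X)).1
    (Subalgebra.fg_def.2 ⟨X, hX, rfl⟩)
  have e : (Algebra.adjoin ℤ X).toSubring = Subring.closure X := by
    rw [Algebra.adjoin_int]; rfl
  rw [← e]
  exact h

/-- Localize at any maximal ideal and dominate the local ring by a valuation ring. Elements whose
inverses also lie in the closure of `X` become units of `V`; this is how nonvanishing is kept under
reduction. -/
theorem ValuationSubring.exists_dominating_finite_residue {F : Type*} [Field F] {X : Set F}
    (hX : X.Finite) :
    ∃ (V : ValuationSubring F) (m : Ideal (Subring.closure X)),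
      Subring.closure X ≤ V.toSubring ∧ m.IsMaximal ∧ Finite (Subring.closure X ⧸ m) ∧
        ∀ r : Subring.closure X, r ∈ m ↔ V.valuation (r : F) < 1 := by
  have hft := Subring.finiteType_int_closure hX
  set R := Subring.closure X with hR
  obtain ⟨m, hm⟩ := Ideal.exists_maximal R
  have hq : Algebra.FiniteType ℤ (R ⧸ m) :=
    Algebra.FiniteType.of_surjective (Ideal.Quotient.mkₐ ℤ m) (Ideal.Quotient.mkₐ_surjective ℤ m)
  obtain ⟨V, hV⟩ := (LocalSubring.ofPrime R m).exists_le_valuationSubring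
  have hle : R ≤ V.toSubring := (LocalSubring.le_ofPrime R m).trans hV.1
  refine ⟨V, m, hle, hm, IsField.finite_of_finiteType_int _
    ((Ideal.Quotient.maximal_ideal_iff_isField_quotient m).1 hm), fun r ↦ ?_⟩
  have hrV : (r : F) ∈ V := hle r.2
  rw [show V.valuation (r : F) = V.valuation ((⟨r, hrV⟩ : V) : F) from rfl,
    ← ValuationSubring.valuation_lt_one_iff, IsLocalRing.mem_maximalIdeal, _root_.mem_nonunits_iff,
    ← not_iff_not, not_not]
  have h1 : IsUnit (⟨r, hrV⟩ : V) ↔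
      IsUnit (⟨r, LocalSubring.le_ofPrime R m r.2⟩ : (LocalSubring.ofPrime R m).toSubring) := by
    constructor
    · intro h
      exact hV.2.1 _ h
    · intro h
      exact h.map (Subring.inclusion hV.1)
  rw [h1]
  exact (IsLocalization.AtPrime.isUnit_to_map_iff (LocalSubring.ofPrime R m).toSubring m r).symm

/-! ### Orders attached to a basis, and their reduction. -/

section

variable {F D ι : Type*} [Field F] [DivisionRing D] [Algebra F D]

/-- The multiplicative structure constants of `e` and the coordinates of `1` lie in `R`. -/
structure Module.Basis.IsDefinedOver (e : Basis ι F D) (R : Subring F) : Prop where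
  repr_mul : ∀ i j k, e.repr (e i * e j) k ∈ R
  repr_one : ∀ k, e.repr 1 k ∈ R

theorem Module.Basis.IsDefinedOver.mono {e : Basis ι F D} {R R' : Subring F}
    (h : e.IsDefinedOver R) (hle : R ≤ R') : e.IsDefinedOver R' :=
  ⟨fun i j k ↦ hle (h.repr_mul i j k), fun k ↦ hle (h.repr_one k)⟩

variable [Fintype ι]

theorem Module.Basis.repr_mul_eq_sum (e : Basis ι F D) (x y : D) (k : ι) :
    e.repr (x * y) k = ∑ i, ∑ j, e.repr x i * e.repr y j * e.repr (e i * e j) k := by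
  conv_lhs => rw [← e.sum_repr x, ← e.sum_repr y]
  simp only [Finset.sum_mul, Finset.mul_sum, map_sum, smul_mul_smul_comm, map_smul,
    Finsupp.coe_finsetSum, Finset.sum_apply, Finsupp.smul_apply, smul_eq_mul]
  rw [Finset.sum_comm]

theorem Module.Basis.mul_comm_of_basis (e : Basis ι F D) (h : ∀ i j, e i * e j = e j * e i) (x y : D) :
    x * y = y * x := by
  rw [← e.sum_repr x, ← e.sum_repr y]
  simp only [Finset.sum_mul, Finset.mul_sum, smul_mul_smul_comm]
  rw [Finset.sum_comm]
  refine Finset.sum_congr rfl fun i _ ↦ Finset.sum_congr rfl fun j _ ↦ ?_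
  rw [h, mul_comm (e.repr y _)]

/-- The subring of elements of `D` whose coordinates with respect to `e` lie in `R`. -/
def Module.Basis.order (e : Basis ι F D) {R : Subring F} (h : e.IsDefinedOver R) : Subring D where
  carrier := {d | ∀ k, e.repr d k ∈ R}
  mul_mem' {x y} hx hy k := by
    rw [e.repr_mul_eq_sum]
    exact sum_mem fun i _ ↦ sum_mem fun j _ ↦ mul_mem (mul_mem (hx i) (hy j)) (h.repr_mul i j k)
  one_mem' := h.repr_one
  add_mem' {x y} hx hy k := by simpa using add_mem (hx k) (hy k)
  zero_mem' k := by simp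
  neg_mem' {x} hx k := by simpa using hx k

namespace Module.Basis

variable {e : Basis ι F D} {R : Subring F} {h : e.IsDefinedOver R}

theorem smul_mem_order {c : F} {d : D} (hc : c ∈ R) (hd : d ∈ e.order h) :
    c • d ∈ e.order h := fun k ↦ by simpa using mul_mem hc (hd k)

theorem basis_mem_order (i : ι) : e i ∈ e.order h := fun k ↦ by
  classical
  rw [e.repr_self_apply]
  split_ifs
  · exact one_mem R
  · exact zero_mem R

theorem exists_finite_isDefinedOver (e : Basis ι F D) {Y : Set D} (hY : Y.Finite) {Z : Set F}
    (hZ : Z.Finite) : ∃ X : Set F, X.Finite ∧ Z ⊆ Subring.closure X ∧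
      e.IsDefinedOver (Subring.closure X) ∧ ∀ y ∈ Y, ∀ k, e.repr y k ∈ Subring.closure X := by
  let T : Set D := Y ∪ {1} ∪ Set.range fun p : ι × ι ↦ e p.1 * e p.2
  have hT : T.Finite := (hY.union (Set.finite_singleton _)).union (Set.finite_range _)
  refine ⟨Z ∪ ⋃ k, (fun d ↦ e.repr d k) '' T,
    hZ.union (Set.finite_iUnion fun k ↦ hT.image _), ?_, ?_⟩
  · exact Set.subset_union_left.trans Subring.subset_closure
  · have key : ∀ y ∈ T, ∀ k, e.repr y k ∈
        Subring.closure (Z ∪ ⋃ k, (fun d ↦ e.repr d k) '' T) := fun y hy k ↦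
      Subring.subset_closure (Or.inr (Set.mem_iUnion.2 ⟨k, ⟨y, hy, rfl⟩⟩))
    exact ⟨⟨fun i j k ↦ key _ (Or.inr ⟨(i, j), rfl⟩) k, fun k ↦ key _ (Or.inl (Or.inr rfl)) k⟩,
      fun y hy k ↦ key y (Or.inl (Or.inl hy)) k⟩

/-- Divide by a coordinate of maximal valuation: the multiple is primitive. -/
theorem exists_smul_mem_order (e : Basis ι F D) {V : ValuationSubring F}
    (h : e.IsDefinedOver V.toSubring) {d : D} (hd : d ≠ 0) :
    ∃ c : F, c ≠ 0 ∧ c • d ∈ e.order h ∧ ∃ k, e.repr (c • d) k = 1 := by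
  have hne : ∃ i, e.repr d i ≠ 0 := by
    by_contra! hcon
    exact hd (e.repr.map_eq_zero_iff.1 (Finsupp.ext hcon))
  obtain ⟨i, hi⟩ := hne
  obtain ⟨k, -, hk⟩ := Finset.exists_max_image Finset.univ (fun k ↦ V.valuation (e.repr d k))
    ⟨i, Finset.mem_univ i⟩
  have hk0 : e.repr d k ≠ 0 := by
    intro h0
    have := hk i (Finset.mem_univ i)
    rw [h0, map_zero, le_zero_iff, map_eq_zero] at this
    exact hi this
  refine ⟨(e.repr d k)⁻¹, inv_ne_zero hk0, fun j ↦ ?_, k, by simp [hk0]⟩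
  change _ ∈ V
  rw [← V.valuation_le_one_iff]
  have hv : 0 < V.valuation (e.repr d k) := by
    rw [zero_lt_iff]; simpa using hk0
  simpa using (inv_mul_le_one₀ hv).2 (hk j (Finset.mem_univ j))

/-- The elements of `D` whose coordinates lie in the maximal ideal of `V`. -/
def radical (e : Basis ι F D) (V : ValuationSubring F) : AddSubgroup D where
  carrier := {d | ∀ k, V.valuation (e.repr d k) < 1}
  add_mem' {x y} hx hy k := by simpa using V.valuation.map_add_lt (hx k) (hy k)
  zero_mem' k := by simp
  neg_mem' {x} hx k := by simpa using hx k

variable {V : ValuationSubring F} {hV : e.IsDefinedOver V.toSubring}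

omit [Fintype ι] in
theorem mem_radical {d : D} : d ∈ e.radical V ↔ ∀ k, V.valuation (e.repr d k) < 1 := Iff.rfl

theorem mem_order_iff_valuation {d : D} :
    d ∈ e.order hV ↔ ∀ k, V.valuation (e.repr d k) ≤ 1 := by
  simp only [V.valuation_le_one_iff]; rfl

theorem mul_mem_radical_left {x y : D} (hx : x ∈ e.radical V) (hy : y ∈ e.order hV) :
    x * y ∈ e.radical V := fun k ↦ by
  rw [e.repr_mul_eq_sum]
  refine V.valuation.map_sum_lt one_ne_zero fun i _ ↦ V.valuation.map_sum_lt one_ne_zero fun j _ ↦ ?_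
  rw [map_mul, map_mul]
  exact mul_lt_one_of_lt_of_le (mul_lt_one_of_lt_of_le (hx i) (mem_order_iff_valuation.1 hy j))
    ((V.valuation_le_one_iff _).2 (hV.repr_mul i j k))

theorem mul_mem_radical_right {x y : D} (hx : x ∈ e.order hV) (hy : y ∈ e.radical V) :
    x * y ∈ e.radical V := fun k ↦ by
  rw [e.repr_mul_eq_sum]
  refine V.valuation.map_sum_lt one_ne_zero fun i _ ↦ V.valuation.map_sum_lt one_ne_zero fun j _ ↦ ?_
  rw [map_mul, map_mul]
  exact mul_lt_one_of_lt_of_le ((mul_le_of_le_one_left' (mem_order_iff_valuation.1 hx i)).trans_lt (hy j))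
    ((V.valuation_le_one_iff _).2 (hV.repr_mul i j k))

theorem smul_mem_radical {c : F} {x : D} (hc : V.valuation c < 1) (hx : x ∈ e.order hV) :
    c • x ∈ e.radical V := fun k ↦ by
  rw [map_smul, Finsupp.smul_apply, smul_eq_mul, map_mul]
  exact (mul_le_of_le_one_right' (mem_order_iff_valuation.1 hx k)).trans_lt hc

omit [Fintype ι] in
theorem basis_notMem_radical (i : ι) : e i ∉ e.radical V := fun hi ↦ by
  simpa using hi i

theorem one_notMem_radical (hV : e.IsDefinedOver V.toSubring) : (1 : D) ∉ e.radical V := fun h1 ↦ by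
  have : Nonempty ι := e.index_nonempty
  obtain ⟨i⟩ := this
  have := mul_mem_radical_left h1 (basis_mem_order (h := hV) i)
  rw [one_mul] at this
  exact basis_notMem_radical i this

/-- If primitive elements of an order over `R` are invertible over the valuation ring `V`,
and `V` has finite residue field over `R`, then the reduced order is a finite domain, so
it is commutative. -/
theorem commutator_mem_radical {m : Ideal R} (h : e.IsDefinedOver R) (hV : e.IsDefinedOver V.toSubring)
    (hle : R ≤ V.toSubring) [Finite (R ⧸ m)] (hm : ∀ r : R, r ∈ m ↔ V.valuation (r : F) < 1)
    (hinv : ∀ x ∈ e.order h, x ∉ e.radical V → x⁻¹ ∈ e.order hV)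
    {x y : D} (hx : x ∈ e.order h) (hy : y ∈ e.order h) : x * y - y * x ∈ e.radical V := by
  have hsub : ∀ z ∈ e.order h, z ∈ e.order hV := fun z hz k ↦ hle (hz k)
  let I : Ideal (e.order h) :=
    { carrier := {z | (z : D) ∈ e.radical V}
      add_mem' := fun ha hb ↦ (e.radical V).add_mem ha hb
      zero_mem' := (e.radical V).zero_mem
      smul_mem' := fun c z hz ↦ mul_mem_radical_right (hsub c c.2) hz }
  have : I.IsTwoSided := ⟨fun {a} b ha ↦ mul_mem_radical_left ha (hsub b b.2)⟩
  have hI : ∀ z, z ∈ I ↔ (z : D) ∈ e.radical V := fun z ↦ Iff.rfl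
  let f : e.order h → ι → R ⧸ m := fun z k ↦ Ideal.Quotient.mk m ⟨e.repr z k, z.2 k⟩
  have hf : ∀ z w, f z = f w ↔ Ideal.Quotient.mk I z = Ideal.Quotient.mk I w := by
    intro z w
    rw [Ideal.Quotient.mk_eq_mk_iff_sub_mem, hI, mem_radical, funext_iff]
    refine forall_congr' fun k ↦ ?_
    rw [Ideal.Quotient.mk_eq_mk_iff_sub_mem, hm]
    simp
  -- A class modulo `I` is determined by its coordinates in the finite ring `R ⧸ m`.
  have : Finite (e.order h ⧸ I) := by
    let g : (e.order h ⧸ I) → ι → R ⧸ m := fun q ↦ f (Quotient.out q)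
    have hg : Function.Injective g := fun p q hpq ↦ by
      have := (hf _ _).1 hpq
      rwa [Ideal.Quotient.mk_out, Ideal.Quotient.mk_out] at this
    exact _root_.Finite.of_injective g hg
  have : Nontrivial (e.order h ⧸ I) := by
    refine ⟨⟨Ideal.Quotient.mk I 1, 0, fun h0 ↦ ?_⟩⟩
    rw [Ideal.Quotient.eq_zero_iff_mem, hI] at h0
    exact one_notMem_radical hV h0
  have : NoZeroDivisors (e.order h ⧸ I) := by
    refine ⟨fun {p q} hpq ↦ ?_⟩
    obtain ⟨a, rfl⟩ := Ideal.Quotient.mk_surjective p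
    obtain ⟨b, rfl⟩ := Ideal.Quotient.mk_surjective q
    rw [← map_mul, Ideal.Quotient.eq_zero_iff_mem, hI] at hpq
    rw [Ideal.Quotient.eq_zero_iff_mem, Ideal.Quotient.eq_zero_iff_mem, hI, hI]
    by_contra! hcon
    have ha0 : (a : D) ≠ 0 := fun h0 ↦ hcon.1 (h0 ▸ zero_mem _)
    have := mul_mem_radical_right (hinv a a.2 hcon.1) hpq
    rw [Subring.coe_mul, inv_mul_cancel_left₀ ha0] at this
    exact hcon.2 this
  have : IsDomain (e.order h ⧸ I) := NoZeroDivisors.to_isDomain _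
  have hcomm := (Finite.isDomain_to_isField (e.order h ⧸ I)).mul_comm
    (Ideal.Quotient.mk I ⟨x, hx⟩) (Ideal.Quotient.mk I ⟨y, hy⟩)
  rw [← map_mul, ← map_mul, Ideal.Quotient.mk_eq_mk_iff_sub_mem, hI] at hcomm
  exact hcomm

end Module.Basis

end

/-! ### Centralizers and two-sided multiplications. -/

/-- An Artin–Whaples argument: if `A` is spanned over `Z` by `k`, then `D` is spanned over the
centralizer of `A` by a family whose multiples by `k` are independent over `D`. -/
theorem Subalgebra.exists_spanning_over_centralizer {Z D n : Type*} [Field Z] [DivisionRing D]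
    [Algebra Z D] [Fintype n] (A : Subalgebra Z D) (k : n → D)
    (hk : Submodule.span Z (Set.range k) = Subalgebra.toSubmodule A) :
    ∃ (l : ℕ) (y : Fin l → D), LinearIndependent D (fun b (i : n) ↦ k i * y b) ∧
      ∀ v, ∃ c : Fin l → D, (∀ b, c b ∈ Subalgebra.centralizer Z (A : Set D)) ∧
        (v = ∑ b, c b * y b) ∧ ∀ i, k i * v = ∑ b, c b * (k i * y b) := by
  let w : D → n → D := fun v i ↦ k i * v
  obtain ⟨κ, a, -, hspan, hind⟩ := exists_linearIndependent' D w
  have : Finite κ := hind.finite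
  obtain ⟨l, ⟨eqv⟩⟩ := Finite.exists_equiv_fin κ
  refine ⟨l, fun b ↦ a (eqv.symm b), hind.comp _ eqv.symm.injective, fun v ↦ ?_⟩
  have hind' : LinearIndependent D fun b ↦ w (a (eqv.symm b)) := hind.comp _ eqv.symm.injective
  have hmem : w v ∈ Submodule.span D (Set.range fun b ↦ w (a (eqv.symm b))) := by
    have h1 : (Set.range fun b ↦ w (a (eqv.symm b))) = Set.range (w ∘ a) :=
      eqv.symm.surjective.range_comp (w ∘ a)
    rw [h1, hspan]
    exact Submodule.subset_span ⟨v, rfl⟩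
  obtain ⟨c, hc⟩ := (Submodule.mem_span_range_iff_exists_fun D).1 hmem
  have hci : ∀ i, k i * v = ∑ b, c b * (k i * a (eqv.symm b)) := fun i ↦ by
    have := congrFun hc i
    simpa [w] using this.symm
  have hcA : ∀ x ∈ A, x * v = ∑ b, c b * (x * a (eqv.symm b)) := by
    intro x hx
    rw [← Subalgebra.mem_toSubmodule, ← hk] at hx
    induction hx using Submodule.span_induction with
    | mem x hx => obtain ⟨i, rfl⟩ := hx; exact hci i
    | zero => simp
    | add x y _ _ hx hy => simp only [add_mul, mul_add, Finset.sum_add_distrib, hx, hy]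
    | smul r x _ hx => simp only [smul_mul_assoc, mul_smul_comm, hx, Finset.smul_sum]
  have hkA : ∀ i, k i ∈ A := fun i ↦ by
    rw [← Subalgebra.mem_toSubmodule, ← hk]
    exact Submodule.subset_span ⟨i, rfl⟩
  refine ⟨c, fun b ↦ ?_, by simpa using hcA 1 (one_mem A), hci⟩
  rw [Subalgebra.mem_centralizer_iff]
  intro x hx
  -- Expand `x * k i * v` in two ways: as `x` times `k i * v`, and as the product of `x * k i ∈ A`
  -- with `v`.
  have hzero : ∑ b, (x * c b - c b * x) • w (a (eqv.symm b)) = 0 := by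
    ext i
    have h1 := hcA (x * k i) (mul_mem hx (hkA i))
    rw [mul_assoc, hci i, Finset.mul_sum] at h1
    simp only [Finset.sum_apply, Pi.smul_apply, smul_eq_mul, Pi.zero_apply, sub_mul,
      Finset.sum_sub_distrib, w]
    rw [sub_eq_zero]
    simpa only [mul_assoc] using h1
  exact sub_eq_zero.1 (Fintype.linearIndependent_iff.1 hind' _ hzero b)

/-- A division algebra with a finite-dimensional self-centralizing subalgebra is
finite-dimensional. -/
theorem Subalgebra.finiteDimensional_of_centralizer_le {Z D : Type*} [Field Z] [DivisionRing D]
    [Algebra Z D] (A : Subalgebra Z D) [FiniteDimensional Z A]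
    (hA : Subalgebra.centralizer Z (A : Set D) ≤ A) : FiniteDimensional Z D := by
  obtain ⟨n, k, hk⟩ := Submodule.fg_iff_exists_fin_generating_family.1
    (Module.Finite.iff_fg.1 (inferInstance : FiniteDimensional Z (Subalgebra.toSubmodule A)))
  obtain ⟨l, y, -, hy⟩ := A.exists_spanning_over_centralizer k hk
  have hfg : (Subalgebra.toSubmodule A * Submodule.span Z (Set.range y)).FG :=
    Submodule.FG.mul (hk ▸ Submodule.fg_span (Set.finite_range k))
      (Submodule.fg_span (Set.finite_range y))
  suffices htop : Subalgebra.toSubmodule A * Submodule.span Z (Set.range y) = ⊤ from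
    ⟨htop ▸ hfg⟩
  rw [eq_top_iff]
  rintro v -
  obtain ⟨c, hc, hv, -⟩ := hy v
  rw [hv]
  exact sum_mem fun b _ ↦ Submodule.mul_mem_mul (hA (hc b)) (Submodule.subset_span ⟨b, rfl⟩)

/-- Coordinate functionals of a central division algebra are given by two-sided multiplications. -/
theorem Module.Basis.exists_sum_mul_mul_eq_repr {F D ι : Type*} [Field F] [DivisionRing D]
    [Algebra F D] [Algebra.IsCentral F D] [Fintype ι] (e : Basis ι F D) (j : ι) :
    ∃ (l : ℕ) (u v : Fin l → D), ∀ x, ∑ b, u b * x * v b = algebraMap F D (e.repr x j) := by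
  classical
  obtain ⟨l, y, hind, hy⟩ := (⊤ : Subalgebra F D).exists_spanning_over_centralizer e
    (by rw [e.span_eq, Algebra.top_toSubmodule])
  have hspan : Submodule.span F (Set.range y) = ⊤ := by
    rw [eq_top_iff]
    rintro v -
    obtain ⟨c, hc, hv, -⟩ := hy v
    rw [hv]
    refine sum_mem fun b _ ↦ ?_
    have hcb : c b ∈ Subalgebra.center F D := by
      rw [Subalgebra.mem_center_iff]
      exact fun x ↦ (Subalgebra.mem_centralizer_iff F).1 (hc b) x trivial
    obtain ⟨r, hr⟩ := Algebra.mem_bot.1 (Algebra.IsCentral.out hcb)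
    rw [← hr, ← Algebra.smul_def]
    exact Submodule.smul_mem _ _ (Submodule.subset_span ⟨b, rfl⟩)
  -- Independence over `D` bounds `l` above; `y` spanning `D` over `F` bounds it below. The vectors
  -- thus form a basis and reach the `j`-th unit vector.
  have hcard : Fintype.card (Fin l) = finrank D (ι → D) := by
    refine le_antisymm hind.fintype_card_le_finrank ?_
    have : FiniteDimensional F D := Module.Finite.of_basis e
    rw [finrank_fintype_fun_eq_card, ← finrank_eq_card_basis e]
    have := finrank_range_le_card (R := F) y
    rwa [Set.finrank, hspan, finrank_top] at this
  have htop := hind.span_eq_top_of_card_eq_finrank' hcard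
  have hmem : (Pi.single j 1 : ι → D) ∈ Submodule.span D (Set.range fun b (i : ι) ↦ e i * y b) := by
    rw [htop]; trivial
  obtain ⟨c, hc⟩ := (Submodule.mem_span_range_iff_exists_fun D).1 hmem
  refine ⟨l, c, y, fun x ↦ ?_⟩
  have hci : ∀ i, ∑ b, c b * e i * y b = if i = j then 1 else 0 := fun i ↦ by
    have := congrFun hc i
    simpa [mul_assoc, Pi.single_apply] using this
  conv_lhs => rw [← e.sum_repr x]
  simp only [Finset.mul_sum, Finset.sum_mul, mul_smul_comm, smul_mul_assoc]
  rw [Finset.sum_comm]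
  simp only [← Finset.smul_sum, hci]
  simp [Algebra.algebraMap_eq_smul_one]

/-! ### The normalizer of an order and the subnormal chain. -/

namespace Module.Basis

variable {F D ι : Type*} [Field F] [DivisionRing D] [Algebra F D] [Fintype ι]
  {e : Basis ι F D} {V : ValuationSubring F} {hV : e.IsDefinedOver V.toSubring}

theorem exists_valuation_eq_one {x : D} (hx : x ∈ e.order hV) (hx' : x ∉ e.radical V) :
    ∃ k, V.valuation (e.repr x k) = 1 := by
  rw [mem_radical] at hx'
  push Not at hx'
  obtain ⟨k, hk⟩ := hx'
  exact ⟨k, le_antisymm (mem_order_iff_valuation.1 hx k) hk⟩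

theorem norm_mem_of_mem_order {x : D} (hx : x ∈ e.order hV) : Algebra.norm F x ∈ V := by
  classical
  rw [Algebra.norm_eq_matrix_det e, Matrix.det_apply]
  refine sum_mem fun σ _ ↦ ?_
  have : ∏ i, Algebra.leftMulMatrix e x (σ i) i ∈ V := by
    refine prod_mem fun i _ ↦ ?_
    rw [Algebra.leftMulMatrix_eq_repr_mul]
    exact mul_mem hx (basis_mem_order i) _
  rcases Int.units_eq_one_or (Equiv.Perm.sign σ) with h | h
  · simpa [h] using this
  · simpa [h] using this

/-- A primitive element normalizing the order is invertible in it, provided the coordinate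
functionals are given by two-sided multiplications by elements of the order. -/
theorem inv_mem_order_of_normalizes
    (hs : ∀ j, ∃ (l : ℕ) (u v : Fin l → D), (∀ b, u b ∈ e.order hV ∧ v b ∈ e.order hV) ∧
      ∀ x, ∑ b, u b * x * v b = algebraMap F D (e.repr x j))
    {x : D} (hx : x ∈ e.order hV) (hx' : x ∉ e.radical V)
    (hnorm : ∀ y ∈ e.order hV, x⁻¹ * y * x ∈ e.order hV) : x⁻¹ ∈ e.order hV := by
  obtain ⟨k, hk⟩ := exists_valuation_eq_one hx hx'
  obtain ⟨l, u, v, huv, hsum⟩ := hs k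
  have hk0 : e.repr x k ≠ 0 := by
    intro h0; simp [h0] at hk
  have hx0 : x ≠ 0 := by
    rintro rfl; simp at hk0
  have h1 : x⁻¹ = (e.repr x k)⁻¹ • ∑ b, (x⁻¹ * u b * x) * v b := by
    have h2 : ∑ b, (x⁻¹ * u b * x) * v b = x⁻¹ * algebraMap F D (e.repr x k) := by
      rw [← hsum x, Finset.mul_sum]
      simp only [mul_assoc]
    rw [h2, ← Algebra.commutes, ← Algebra.smul_def, smul_smul, inv_mul_cancel₀ hk0, one_smul]
  rw [h1]
  refine smul_mem_order ?_ (sum_mem fun b _ ↦ mul_mem (hnorm _ (huv b).1) (huv b).2)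
  change _ ∈ V
  rw [← V.valuation_le_one_iff, map_inv₀, hk, inv_one]

/-- A primitive multiple `c • x` is invertible in the order, so `(c • x)⁻¹ * a` is integral. Its
norm is a power of `c⁻¹`, hence `c⁻¹ ∈ V` and `x` itself is integral. -/
theorem mem_order_of_norm_eq
    (hs : ∀ j, ∃ (l : ℕ) (u v : Fin l → D), (∀ b, u b ∈ e.order hV ∧ v b ∈ e.order hV) ∧
      ∀ x, ∑ b, u b * x * v b = algebraMap F D (e.repr x j))
    {x a : D} (hx0 : x ≠ 0) (hnorm : ∀ y ∈ e.order hV, x⁻¹ * y * x ∈ e.order hV)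
    (ha : a ∈ e.order hV) (hxa : Algebra.norm F x = Algebra.norm F a) :
    x ∈ e.order hV := by
  obtain ⟨c, hc0, hcx, k, hk⟩ := e.exists_smul_mem_order hV hx0
  have hrad : c • x ∉ e.radical V := fun h ↦ by
    have := h k
    rw [hk, map_one] at this
    exact lt_irrefl _ this
  have hinv : (c • x)⁻¹ ∈ e.order hV := by
    refine inv_mem_order_of_normalizes hs hcx hrad fun y hy ↦ ?_
    have : (c • x)⁻¹ * y * (c • x) = x⁻¹ * y * x := by
      rw [Algebra.smul_def, mul_inv_rev, ← map_inv₀, mul_assoc, mul_assoc, ← mul_assoc y,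
        ← Algebra.commutes c y, mul_assoc, ← mul_assoc (algebraMap F D c⁻¹), ← map_mul,
        inv_mul_cancel₀ hc0, map_one, one_mul, mul_assoc]
    rw [this]
    exact hnorm y hy
  have hFD : FiniteDimensional F D := Module.Finite.of_basis e
  have hcn : ((c⁻¹) ^ finrank F D : F) ∈ V := by
    have h3 : Algebra.norm F ((c • x)⁻¹ * a) = (c⁻¹) ^ finrank F D := by
      rw [Algebra.smul_def, mul_inv_rev, map_mul, map_mul, ← hxa, ← map_inv₀,
        Algebra.norm_algebraMap, mul_right_comm, ← map_mul, inv_mul_cancel₀ hx0, map_one, one_mul]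
    exact h3 ▸ norm_mem_of_mem_order (mul_mem hinv ha)
  have hcV : c⁻¹ ∈ V := by
    rw [← V.valuation_le_one_iff] at hcn ⊢
    rw [map_pow] at hcn
    exact (pow_le_one_iff finrank_pos.ne').1 hcn
  have h4 : x = c⁻¹ • (c • x) := by rw [smul_smul, inv_mul_cancel₀ hc0, one_smul]
  rw [h4]
  exact smul_mem_order hcV hcx

/-- The units of `D` conjugating the order into itself in both directions. -/
def orderNormalizer (e : Basis ι F D) (hV : e.IsDefinedOver V.toSubring) : Subgroup Dˣ where
  carrier := {x | (∀ y ∈ e.order hV, (x : D)⁻¹ * y * x ∈ e.order hV) ∧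
    ∀ y ∈ e.order hV, (x : D) * y * (x : D)⁻¹ ∈ e.order hV}
  one_mem' := by simp
  mul_mem' {x z} hx hz := by
    refine ⟨fun y hy ↦ ?_, fun y hy ↦ ?_⟩
    · have := hz.1 _ (hx.1 y hy)
      simpa only [Units.val_mul, mul_inv_rev, mul_assoc] using this
    · have := hx.2 _ (hz.2 y hy)
      simpa only [Units.val_mul, mul_inv_rev, mul_assoc] using this
  inv_mem' {x} hx := by
    refine ⟨fun y hy ↦ ?_, fun y hy ↦ ?_⟩
    · simpa using hx.2 y hy
    · simpa using hx.1 y hy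

/-- Climb the chain from `N`. If `H` normalizes the order and is normal in `K`, a `K`-conjugate of a
basis element in `N` lies in `H` and keeps its norm, so it is integral by `mem_order_of_norm_eq`; as
the basis comes from `N`, all of `K` normalizes the order. -/
theorem orderNormalizer_eq_top_of_isSubnormal
    (hs : ∀ j, ∃ (l : ℕ) (u v : Fin l → D), (∀ b, u b ∈ e.order hV ∧ v b ∈ e.order hV) ∧
      ∀ x, ∑ b, u b * x * v b = algebraMap F D (e.repr x j))
    {N : Subgroup Dˣ} (hN : N.IsSubnormal) (he : ∀ i, ∃ n ∈ N, (n : D) = e i)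
    (hNV : ∀ n ∈ N, (n : D) ∈ e.order hV) : e.orderNormalizer hV = ⊤ := by
  have hbase : N ≤ e.orderNormalizer hV := by
    intro n hn
    have hinv : (n : D)⁻¹ ∈ e.order hV := by
      simpa using hNV n⁻¹ (inv_mem hn)
    exact ⟨fun y hy ↦ mul_mem (mul_mem hinv hy) (hNV n hn),
      fun y hy ↦ mul_mem (mul_mem (hNV n hn) hy) hinv⟩
  suffices h : ∀ H : Subgroup Dˣ, H.IsSubnormal → N ≤ H → H ≤ e.orderNormalizer hV →
      e.orderNormalizer hV = ⊤ from h N hN le_rfl hbase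
  intro H hH
  induction hH with
  | top => exact fun _ h ↦ top_le_iff.1 h
  | step H K hHK hK hnormal ih =>
    intro hNH hHU
    refine ih (hNH.trans hHK) ?_
    have key : ∀ c ∈ K, ∀ y ∈ e.order hV, (c : D) * y * (c : D)⁻¹ ∈ e.order hV := by
      intro c hc y hy
      rw [← e.sum_repr y, Finset.mul_sum, Finset.sum_mul]
      refine sum_mem fun i _ ↦ ?_
      rw [mul_smul_comm, smul_mul_assoc]
      refine smul_mem_order (hy i) ?_
      obtain ⟨n, hn, hni⟩ := he i
      have hconj : c * n * c⁻¹ ∈ H :=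
        hnormal.conj_mem ⟨n, hHK (hNH hn)⟩ (hNH hn) ⟨c, hc⟩
      rw [← hni]
      have hU := (hHU hconj).1
      have hval : ((c * n * c⁻¹ : Dˣ) : D) = (c : D) * n * (c : D)⁻¹ := by simp
      rw [← hval]
      refine mem_order_of_norm_eq hs (Units.ne_zero _) hU (hNV n hn) ?_
      rw [hval, map_mul, map_mul, mul_right_comm, ← map_mul, mul_inv_cancel₀ c.ne_zero, map_one,
        one_mul]
    intro c hc
    refine ⟨fun y hy ↦ ?_, key c hc⟩
    simpa using key c⁻¹ (inv_mem hc) y hy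

end Module.Basis

/-- A finitely generated subnormal subgroup spanning a finite-dimensional central division algebra
forces the algebra to be commutative. -/
theorem mul_comm_of_fg_isSubnormal_of_span_eq_top {F D : Type*} [Field F] [DivisionRing D]
    [Algebra F D] [Algebra.IsCentral F D] [FiniteDimensional F D] {N : Subgroup Dˣ}
    (hN : N.IsSubnormal) (hfg : N.FG)
    (hspan : Submodule.span F ((fun n : Dˣ ↦ (n : D)) '' N) = ⊤) (x y : D) : x * y = y * x := by
  obtain ⟨b, hbN, hbspan, hbind⟩ := exists_linearIndependent F ((fun n : Dˣ ↦ (n : D)) '' N)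
  have hbfin : Finite b := hbind.finite
  have := Fintype.ofFinite b
  let e : Basis b F D := Basis.mk hbind (by rw [Subtype.range_coe, hbspan, hspan])
  have he : ∀ i, ∃ n ∈ N, (n : D) = e i := fun i ↦ by
    obtain ⟨n, hn, hni⟩ := hbN i.2
    exact ⟨n, hn, by simp [e, hni]⟩
  refine e.mul_comm_of_basis ?_ x y
  by_contra! hcon
  obtain ⟨i, j, hij⟩ := hcon
  have hz : ∃ k, e.repr (e i * e j - e j * e i) k ≠ 0 := by
    by_contra! hcon
    exact hij (sub_eq_zero.1 (e.repr.map_eq_zero_iff.1 (Finsupp.ext hcon)))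
  obtain ⟨k, hk⟩ := hz
  choose l u v huv using e.exists_sum_mul_mul_eq_repr
  obtain ⟨S, hS⟩ := hfg
  let Y : Set D := (⋃ j, Set.range (u j) ∪ Set.range (v j)) ∪
    ((fun n : Dˣ ↦ (n : D)) '' S ∪ (fun n : Dˣ ↦ ((n⁻¹ : Dˣ) : D)) '' S)
  have hY : Y.Finite := (Set.finite_iUnion fun j ↦ (Set.finite_range _).union
    (Set.finite_range _)).union ((S.finite_toSet.image _).union (S.finite_toSet.image _))
  -- Including the inverse of a nonzero coordinate of a commutator makes that coordinate a unit of
  -- `V`, so the commutator cannot lie in the radical.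
  obtain ⟨X, hX, hZX, hdef, hYX⟩ := e.exists_finite_isDefinedOver hY
    (Set.finite_singleton (e.repr (e i * e j - e j * e i) k)⁻¹)
  obtain ⟨V, m, hle, -, hfin, hm⟩ := ValuationSubring.exists_dominating_finite_residue hX
  have hV := hdef.mono hle
  have hYV : ∀ y ∈ Y, y ∈ e.order hV := fun y hy k ↦ hle (hYX y hy k)
  have hs : ∀ j, ∃ (l : ℕ) (u v : Fin l → D), (∀ b, u b ∈ e.order hV ∧ v b ∈ e.order hV) ∧
      ∀ x, ∑ b, u b * x * v b = algebraMap F D (e.repr x j) := fun j ↦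
    ⟨l j, u j, v j, fun b ↦
      ⟨hYV _ (Or.inl (Set.mem_iUnion.2 ⟨j, Or.inl ⟨b, rfl⟩⟩)),
        hYV _ (Or.inl (Set.mem_iUnion.2 ⟨j, Or.inr ⟨b, rfl⟩⟩))⟩, huv j⟩
  have hNV : ∀ n ∈ N, (n : D) ∈ e.order hV ∧ ((n⁻¹ : Dˣ) : D) ∈ e.order hV := by
    intro n hn
    rw [← hS] at hn
    induction hn using Subgroup.closure_induction with
    | mem n hn => exact ⟨hYV _ (Or.inr (Or.inl ⟨n, hn, rfl⟩)), hYV _ (Or.inr (Or.inr ⟨n, hn, rfl⟩))⟩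
    | one => simp [one_mem]
    | mul a b _ _ ha hb =>
      rw [mul_inv_rev, Units.val_mul, Units.val_mul]
      exact ⟨mul_mem ha.1 hb.1, mul_mem hb.2 ha.2⟩
    | inv a _ ha => rw [inv_inv]; exact ⟨ha.2, ha.1⟩
  have htop := Basis.orderNormalizer_eq_top_of_isSubnormal hs hN he fun n hn ↦ (hNV n hn).1
  have hmem := Basis.commutator_mem_radical hdef hV hle hm (fun z hz hz' ↦ by
    have hz0 : z ≠ 0 := fun h0 ↦ hz' (h0 ▸ zero_mem _)
    have hU : Units.mk0 z hz0 ∈ e.orderNormalizer hV := htop ▸ Subgroup.mem_top _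
    exact Basis.inv_mem_order_of_normalizes hs (fun k ↦ hle (hz k)) hz' hU.1)
    (Basis.basis_mem_order i) (Basis.basis_mem_order j)
  have h1 := hmem k
  have h2 : V.valuation (e.repr (e i * e j - e j * e i) k)⁻¹ ≤ 1 :=
    (V.valuation_le_one_iff _).2 (hle (hZX rfl))
  rw [map_inv₀, inv_le_one₀ (by rw [zero_lt_iff]; simpa using hk)] at h2
  exact absurd h1 h2.not_gt

/-! ### Commutative subnormal subgroups. -/

namespace Module.Basis

variable {F D ι : Type*} [Field F] [DivisionRing D] [Algebra F D] [Fintype ι]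

theorem mul_comm_of_finite {e : Basis ι F D} {R : Subring F} (h : e.IsDefinedOver R) [Finite R]
    (x y : D) : x * y = y * x := by
  refine e.mul_comm_of_basis (fun i j ↦ ?_) x y
  let f : e.order h → ι → R := fun z k ↦ ⟨e.repr z k, z.2 k⟩
  have hf : Function.Injective f := fun z w hzw ↦ Subtype.ext <| e.repr.injective <|
    Finsupp.ext fun k ↦ congrArg Subtype.val (congrFun hzw k)
  have : Finite (e.order h) := _root_.Finite.of_injective f hf
  exact congrArg Subtype.val ((Finite.isDomain_to_isField (e.order h)).mul_comm
    ⟨e i, basis_mem_order i⟩ ⟨e j, basis_mem_order j⟩)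

variable {e : Basis ι F D} {V : ValuationSubring F} {hV : e.IsDefinedOver V.toSubring}

/-- Scale `u⁻¹` to a primitive `c • u⁻¹`. If `c` were in the maximal ideal, `c • u⁻¹ = c • 1 - (u -
1) * (c • u⁻¹)` would lie in the radical. -/
theorem inv_mem_order_of_sub_one_mem_radical {u : D} (hu : u ∈ e.order hV)
    (hu1 : u - 1 ∈ e.radical V) : u ≠ 0 ∧ u⁻¹ ∈ e.order hV := by
  have hu0 : u ≠ 0 := by
    rintro rfl
    rw [zero_sub, neg_mem_iff] at hu1
    exact one_notMem_radical hV hu1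
  refine ⟨hu0, ?_⟩
  obtain ⟨c, hc0, hcu, k, hk⟩ := e.exists_smul_mem_order hV (inv_ne_zero hu0)
  have hrad : c • u⁻¹ ∉ e.radical V := fun h ↦ by
    have := h k
    rw [hk, map_one] at this
    exact lt_irrefl _ this
  have hc : c⁻¹ ∈ V := by
    rw [← V.valuation_le_one_iff]
    by_contra! hlt
    rw [map_inv₀, one_lt_inv₀ (by rw [zero_lt_iff]; simpa using hc0)] at hlt
    refine hrad ?_
    have h1 : c • u⁻¹ = c • (1 : D) - (u - 1) * (c • u⁻¹) := by
      rw [sub_mul, mul_smul_comm, mul_inv_cancel₀ hu0, one_mul, sub_sub_cancel]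
    rw [h1]
    exact sub_mem (smul_mem_radical (hV := hV) hlt (one_mem _)) (mul_mem_radical_left hu1 hcu)
  have h2 : u⁻¹ = c⁻¹ • (c • u⁻¹) := by rw [smul_smul, inv_mul_cancel₀ hc0, one_smul]
  rw [h2]
  exact smul_mem_order hc hcu

/-- Commutators with `a` of elements congruent to `1` modulo `π`, modulo `π ^ 2`. -/
theorem exists_commutator_eq {π : F} (hπ : V.valuation π < 1) {a y z u : D} (ha0 : a ≠ 0)
    (ha : a ∈ e.order hV) (ha' : a⁻¹ ∈ e.order hV) (hy : y ∈ e.order hV) (hz : z ∈ e.order hV)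
    (hu : u = 1 + π • y + (π * π) • z) : ∃ z' ∈ e.order hV,
      u * a * u⁻¹ * a⁻¹ = 1 + π • (y - a * y * a⁻¹) + (π * π) • z' := by
  have hπV : π ∈ V := (V.valuation_le_one_iff _).1 hπ.le
  set s := y + π • z with hs
  have hsm : s ∈ e.order hV := add_mem hy (smul_mem_order hπV hz)
  have hus : u = 1 + π • s := by rw [hu, hs, smul_add, smul_smul, add_assoc]
  obtain ⟨hu0, huinv⟩ := inv_mem_order_of_sub_one_mem_radical (e := e) (hV := hV) (u := u)
    (hus ▸ add_mem (one_mem _) (smul_mem_order hπV hsm))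
    (by rw [hus, add_sub_cancel_left]; exact smul_mem_radical hπ hsm)
  have h1 : u⁻¹ = 1 - π • (s * u⁻¹) := by
    rw [eq_sub_iff_add_eq, ← smul_mul_assoc]
    nth_rewrite 1 [← one_mul u⁻¹]
    rw [← add_mul, ← hus, mul_inv_cancel₀ hu0]
  have h2 : u * a = a * u + π • (y * a - a * y) + (π * π) • (z * a - a * z) := by
    rw [hu]
    simp only [mul_add, add_mul, one_mul, mul_one, smul_mul_assoc, mul_smul_comm, smul_sub]
    abel
  refine ⟨(z * a - a * z) * u⁻¹ * a⁻¹ - (y * a - a * y) * (s * u⁻¹) * a⁻¹,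
    sub_mem (mul_mem (mul_mem (sub_mem (mul_mem hz ha) (mul_mem ha hz)) huinv) ha')
      (mul_mem (mul_mem (sub_mem (mul_mem hy ha) (mul_mem ha hy)) (mul_mem hsm huinv)) ha'), ?_⟩
  have h3 : (y * a - a * y) * u⁻¹ = (y * a - a * y) - π • ((y * a - a * y) * (s * u⁻¹)) := by
    conv_lhs => rw [h1, mul_sub, mul_one, mul_smul_comm]
  have h4 : (y * a - a * y) * a⁻¹ = y - a * y * a⁻¹ := by
    rw [sub_mul, mul_assoc, mul_inv_cancel₀ ha0, mul_one]
  rw [h2, add_mul, add_mul, add_mul, add_mul, mul_assoc a, mul_inv_cancel₀ hu0, mul_one,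
    mul_inv_cancel₀ ha0, smul_mul_assoc, h3, smul_mul_assoc, sub_mul, h4, smul_mul_assoc,
    smul_sub, smul_smul, smul_mul_assoc, smul_mul_assoc]
  simp only [smul_sub]
  abel

end Module.Basis

/-- Each level of the subnormal chain costs one more commutator with `a`, which sends `K` into its
normal subgroup `H`. -/
theorem Subgroup.IsSubnormal.exists_iterate_commutator_eq_one {G : Type*} [Group G]
    {N : Subgroup G} (hN : N.IsSubnormal) (hcomm : ∀ a ∈ N, ∀ b ∈ N, a * b = b * a) {a : G}
    (ha : a ∈ N) : ∃ k : ℕ, ∀ x : G, (fun x ↦ ⁅x, a⁆)^[k + 1] x = 1 := by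
  suffices h : ∀ H : Subgroup G, H.IsSubnormal → a ∈ H →
      (∃ k : ℕ, ∀ x ∈ H, (fun x ↦ ⁅x, a⁆)^[k + 1] x = 1) →
      ∃ k : ℕ, ∀ x : G, (fun x ↦ ⁅x, a⁆)^[k + 1] x = 1 from
    h N hN ha ⟨0, fun x hx ↦ commutatorElement_eq_one_iff_mul_comm.2 (hcomm x hx a ha)⟩
  intro H hH
  induction hH with
  | top => exact fun _ ⟨k, hk⟩ ↦ ⟨k, fun x ↦ hk x trivial⟩
  | step H K hHK hK hnormal ih =>
    rintro haH ⟨k, hk⟩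
    refine ih (hHK haH) ⟨k + 1, fun x hx ↦ ?_⟩
    rw [Function.iterate_succ_apply]
    refine hk _ ?_
    have : x * a * x⁻¹ ∈ H := hnormal.conj_mem ⟨a, hHK haH⟩ haH ⟨x, hx⟩
    exact mul_mem this (inv_mem haH)

section

variable {F D : Type*} [Field F] [DivisionRing D] [Algebra F D]

/-- The operator `y ↦ y - a * y * a⁻¹`. -/
def subConj (F : Type*) {D : Type*} [Field F] [DivisionRing D] [Algebra F D] (a : D) :
    Module.End F D :=
  1 - LinearMap.mulLeft F a * LinearMap.mulRight F a⁻¹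

theorem subConj_apply (a y : D) : subConj F a y = y - a * y * a⁻¹ := by
  simp [subConj, mul_assoc]

/-- Each commutator with `a` applies `subConj F a` to the first-order term of `1 + π • b`. Once the
iterate is `1`, that term is divisible by `π`, hence lies in the radical, although one of its
coordinates was made a unit. -/
theorem subConj_pow_eq_zero_of_iterate_commutator_eq_one [FiniteDimensional F D] {a : Dˣ} {k : ℕ}
    (hk : ∀ x : Dˣ, (fun x ↦ ⁅x, a⁆)^[k + 1] x = 1) : subConj F (a : D) ^ (k + 1) = 0 := by
  ext b
  rw [LinearMap.zero_apply]
  by_contra hb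
  let e := Module.finBasis F D
  have hz : ∃ j, e.repr ((subConj F (a : D) ^ (k + 1)) b) j ≠ 0 := by
    by_contra! hcon
    exact hb (e.repr.map_eq_zero_iff.1 (Finsupp.ext hcon))
  obtain ⟨j, hj⟩ := hz
  obtain ⟨X, hX, hZX, hdef, hYX⟩ := e.exists_finite_isDefinedOver
    (Y := {(a : D), (a : D)⁻¹, b}) (by simp)
    (Set.finite_singleton (e.repr ((subConj F (a : D) ^ (k + 1)) b) j)⁻¹)
  obtain ⟨V, m, hle, -, hfin, hm⟩ := ValuationSubring.exists_dominating_finite_residue hX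
  have hV := hdef.mono hle
  have hYV : ∀ y ∈ ({(a : D), (a : D)⁻¹, b} : Set D), y ∈ e.order hV :=
    fun y hy k ↦ hle (hYX y hy k)
  have ha : (a : D) ∈ e.order hV := hYV _ (by simp)
  have ha' : (a : D)⁻¹ ∈ e.order hV := hYV _ (by simp)
  have hbV : b ∈ e.order hV := hYV _ (by simp)
  -- If `m = ⊥` there is no nonzero `π`, but the coefficient ring is finite and `D` is commutative.
  by_cases hbot : m = ⊥
  · have : Finite (Subring.closure X) := by
      subst hbot
      exact Finite.of_equiv _ (RingEquiv.quotientBot _).toEquiv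
    apply hb
    rw [pow_succ, Module.End.mul_apply, subConj_apply, Basis.mul_comm_of_finite hdef (a : D) b]
    simp
  obtain ⟨π, hπm, hπ0⟩ := Submodule.exists_mem_ne_zero_of_ne_bot hbot
  have hπ : V.valuation (π : F) < 1 := (hm π).1 hπm
  have hπF : (π : F) ≠ 0 := by simpa using hπ0
  have hπV : (π : F) ∈ V := (V.valuation_le_one_iff _).1 hπ.le
  have hu := Basis.inv_mem_order_of_sub_one_mem_radical (e := e) (hV := hV)
    (u := 1 + (π : F) • b) (add_mem (one_mem _) (Basis.smul_mem_order hπV hbV))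
    (by rw [add_sub_cancel_left]; exact Basis.smul_mem_radical hπ hbV)
  have key : ∀ i : ℕ, (subConj F (a : D) ^ i) b ∈ e.order hV ∧ ∃ z ∈ e.order hV,
      (((fun x ↦ ⁅x, a⁆)^[i] (Units.mk0 _ hu.1) : Dˣ) : D) =
        1 + (π : F) • (subConj F (a : D) ^ i) b + ((π : F) * π) • z := by
    intro i
    induction i with
    | zero => exact ⟨hbV, 0, zero_mem _, by simp⟩
    | succ i ih =>
      obtain ⟨hyi, z, hz, hzu⟩ := ih
      obtain ⟨z', hz', hzu'⟩ := Basis.exists_commutator_eq hπ a.ne_zero ha ha' hyi hz hzu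
      rw [pow_succ', Module.End.mul_apply, subConj_apply, Function.iterate_succ_apply',
        commutatorElement_def]
      refine ⟨sub_mem hyi (mul_mem (mul_mem ha hyi) ha'), z', hz', ?_⟩
      rw [← hzu']
      simp
  obtain ⟨-, z, hz, hzu⟩ := key (k + 1)
  rw [hk, Units.val_one, add_assoc, left_eq_add, mul_smul, ← smul_add, smul_eq_zero_iff_right hπF,
    add_eq_zero_iff_eq_neg] at hzu
  have hmem : (subConj F (a : D) ^ (k + 1)) b ∈ e.radical V :=
    hzu ▸ neg_mem (Basis.smul_mem_radical hπ hz)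
  have h2 : V.valuation (e.repr ((subConj F (a : D) ^ (k + 1)) b) j)⁻¹ ≤ 1 :=
    (V.valuation_le_one_iff _).2 (hle (hZX rfl))
  rw [map_inv₀, inv_le_one₀ (by rw [zero_lt_iff]; simpa using hj)] at h2
  exact absurd (hmem j) h2.not_gt

/-- Otherwise `1` has the form `w - a * w * a⁻¹`, so left multiplication by `1` has trace zero,
whereas this trace is the dimension. -/
theorem subConj_eq_zero_of_isNilpotent [FiniteDimensional F D] [CharZero F] {a : D} (ha0 : a ≠ 0)
    (h : IsNilpotent (subConj F a)) : subConj F a = 0 := by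
  by_contra hne
  have hpos : 2 ≤ nilpotencyClass (subConj F a) := by
    by_contra! hlt
    have := pow_nilpotencyClass h
    interval_cases hn : nilpotencyClass (subConj F a)
    · simp at this
    · exact hne (by simpa using this)
  obtain ⟨n, hn⟩ := Nat.exists_eq_add_of_le' hpos
  have hn1 : subConj F a ^ (n + 1) ≠ 0 := by
    simpa [hn] using pow_pred_nilpotencyClass h
  have hn2 : subConj F a ^ (n + 2) = 0 := hn ▸ pow_nilpotencyClass h
  obtain ⟨v, hv⟩ : ∃ v, (subConj F a ^ (n + 1)) v ≠ 0 := by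
    by_contra! hcon
    exact hn1 (LinearMap.ext hcon)
  set y := (subConj F a ^ n) v
  set z := subConj F a y with hz
  have hz0 : z ≠ 0 := by
    rwa [pow_succ', Module.End.mul_apply] at hv
  have hz1 : subConj F a z = 0 := by
    have := LinearMap.congr_fun hn2 v
    rwa [pow_succ', pow_succ', Module.End.mul_apply, Module.End.mul_apply] at this
  have hza : z⁻¹ * a = a * z⁻¹ := by
    rw [subConj_apply, sub_eq_zero, eq_mul_inv_iff_mul_eq₀ ha0] at hz1
    -- The operator is linear over the centralizer of `a`, so `z⁻¹` can be pulled through it.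
    exact (Commute.inv_left₀ hz1 : Commute z⁻¹ a)
  have hone : subConj F a (z⁻¹ * y) = 1 := by
    rw [subConj_apply, ← mul_assoc, ← hza, mul_assoc, mul_assoc, ← mul_sub, ← mul_assoc a,
      ← subConj_apply (F := F), ← hz, inv_mul_cancel₀ hz0]
  have htr : LinearMap.trace F D (Algebra.lmul F D (a * (z⁻¹ * y) * a⁻¹)) =
      LinearMap.trace F D (Algebra.lmul F D (z⁻¹ * y)) := by
    rw [map_mul, LinearMap.trace_mul_comm, ← map_mul, ← mul_assoc, inv_mul_cancel₀ ha0, one_mul]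
  have h1 : LinearMap.trace F D (Algebra.lmul F D 1) = 0 := by
    rw [← hone, subConj_apply, map_sub, map_sub, htr, sub_self]
  rw [map_one, LinearMap.trace_one, Nat.cast_eq_zero] at h1
  exact finrank_pos.ne' h1

/-- Right minus left multiplication by `a` is `subConj F a` times a commuting operator, hence
nilpotent; its `p ^ k`-th power is the same difference for `a ^ p ^ k`. -/
theorem commute_pow_of_isNilpotent_subConj {p : ℕ} [Fact p.Prime] [CharP F p] {a : D} (ha0 : a ≠ 0)
    (h : IsNilpotent (subConj F a)) : ∃ m : ℕ, ∀ y, a ^ p ^ m * y = y * a ^ p ^ m := by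
  obtain ⟨k, hk⟩ := h
  have : CharP (Module.End F D) p :=
    charP_of_injective_algebraMap (algebraMap F (Module.End F D)).injective p
  have hmul : LinearMap.mulRight F a - LinearMap.mulLeft F a =
      subConj F a * LinearMap.mulRight F a := by
    ext y
    rw [Module.End.mul_apply, LinearMap.sub_apply, subConj_apply, LinearMap.mulLeft_apply,
      LinearMap.mulRight_apply, mul_assoc a, mul_assoc y, mul_inv_cancel₀ ha0, mul_one]
  refine ⟨k, fun y ↦ ?_⟩
  have h1 : (LinearMap.mulRight F a - LinearMap.mulLeft F a) ^ p ^ k = 0 := by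
    have hc : Commute (subConj F a) (LinearMap.mulRight F a) := by
      ext y
      rw [Module.End.mul_apply, Module.End.mul_apply, subConj_apply, LinearMap.mulRight_apply,
        LinearMap.mulRight_apply, subConj_apply]
      rw [sub_mul, mul_assoc _ a⁻¹ a, inv_mul_cancel₀ ha0, mul_one, mul_assoc a (y * a),
        mul_assoc y, mul_inv_cancel₀ ha0, mul_one]
    rw [hmul, hc.mul_pow, pow_eq_zero_of_le (Nat.lt_pow_self (Fact.out : p.Prime).one_lt).le hk,
      zero_mul]
  rw [sub_pow_char_pow_of_commute _ _ (LinearMap.commute_mulLeft_right a a).symm, LinearMap.pow_mulLeft,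
    LinearMap.pow_mulRight] at h1
  simpa [sub_eq_zero, eq_comm] using LinearMap.congr_fun h1 y

/-- Shorten the iteration. If `⁅g, a⁆` commutes with `a`, centrality of `a ^ p ^ m` gives `⁅g, a⁆ ^
p ^ m = 1`, and in characteristic `p` this forces `⁅g, a⁆ = 1`. -/
theorem commute_of_commute_pow_of_iterate_commutator {p m : ℕ} [Fact p.Prime] [CharP D p] {a : Dˣ}
    (ha : ∀ y : D, (a : D) ^ p ^ m * y = y * (a : D) ^ p ^ m) {k : ℕ}
    (hk : ∀ x : Dˣ, (fun x ↦ ⁅x, a⁆)^[k + 1] x = 1) (x : Dˣ) : x * a = a * x := by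
  induction k with
  | zero => exact commutatorElement_eq_one_iff_mul_comm.1 (hk x)
  | succ k ih =>
    refine ih fun x ↦ ?_
    have h1 := hk x
    rw [Function.iterate_succ_apply', Function.iterate_succ_apply'] at h1
    rw [Function.iterate_succ_apply']
    set g := (fun x ↦ ⁅x, a⁆)^[k] x
    have hca : Commute ⁅g, a⁆ a := commutatorElement_eq_one_iff_mul_comm.1 h1
    have hconj : g * a * g⁻¹ = ⁅g, a⁆ * a := by
      rw [commutatorElement_def, inv_mul_cancel_right]
    have hpow : ⁅g, a⁆ ^ p ^ m = 1 := by
      have h2 : g * a ^ p ^ m * g⁻¹ = ⁅g, a⁆ ^ p ^ m * a ^ p ^ m := by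
        rw [← hca.mul_pow, ← hconj, conj_pow]
      have h3 : g * a ^ p ^ m = a ^ p ^ m * g := Units.ext (by simpa using (ha g).symm)
      rw [h3, mul_inv_cancel_right] at h2
      exact right_eq_mul.1 h2
    have h4 : ((⁅g, a⁆ : Dˣ) - 1 : D) ^ p ^ m = 0 := by
      rw [sub_pow_char_pow_of_commute _ _ (Commute.one_right _), one_pow, ← Units.val_pow_eq_pow_val,
        hpow, Units.val_one, sub_self]
    exact Units.ext (by simpa [sub_eq_zero] using eq_zero_of_pow_eq_zero h4)

/-- Commutative subnormal subgroups of the unit group of a finite-dimensional division algebra are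
central. -/
theorem Subgroup.IsSubnormal.commute_of_commutative [FiniteDimensional F D] {N : Subgroup Dˣ}
    (hN : N.IsSubnormal) (hcomm : ∀ a ∈ N, ∀ b ∈ N, a * b = b * a) {a : Dˣ} (ha : a ∈ N) (y : D) :
    y * a = a * y := by
  obtain ⟨k, hk⟩ := hN.exists_iterate_commutator_eq_one hcomm ha
  have hnil : IsNilpotent (subConj F (a : D)) :=
    ⟨k + 1, subConj_pow_eq_zero_of_iterate_commutator_eq_one hk⟩
  obtain ⟨p, hp⟩ := CharP.exists F
  rcases CharP.char_is_prime_or_zero F p with hprime | rfl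
  · have : Fact p.Prime := ⟨hprime⟩
    have : CharP D p := charP_of_injective_algebraMap (algebraMap F D).injective p
    obtain ⟨m, hm⟩ := commute_pow_of_isNilpotent_subConj (p := p) a.ne_zero hnil
    rcases eq_or_ne y 0 with rfl | hy
    · simp
    · exact congrArg Units.val
        (commute_of_commute_pow_of_iterate_commutator hm hk (Units.mk0 y hy))
  · have : CharZero F := CharP.charP_to_charZero F
    have h0 := LinearMap.congr_fun (subConj_eq_zero_of_isNilpotent a.ne_zero hnil) y
    rwa [subConj_apply, LinearMap.zero_apply, sub_eq_zero, eq_mul_inv_iff_mul_eq₀ a.ne_zero] at h0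

end

/-! ### Passage to division subrings and the finite-dimensional theorem. -/

section

variable {F D : Type*} [Field F] [DivisionRing D] [Algebra F D]

theorem Subring.span_center_eq_top {s : Set D} (hs : Submodule.span F s = ⊤) :
    Submodule.span (Subring.center D) s = ⊤ := by
  rw [eq_top_iff]
  rintro x -
  have hx : x ∈ Submodule.span F s := hs ▸ trivial
  induction hx using Submodule.span_induction with
  | mem x hx => exact Submodule.subset_span hx
  | zero => exact zero_mem _
  | add x y _ _ hx hy => exact add_mem hx hy
  | smul r x _ hx =>
    have hr : algebraMap F D r ∈ Subring.center D :=
      Subring.mem_center_iff.2 fun y ↦ (Algebra.commutes r y).symm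
    rw [Algebra.smul_def]
    exact Submodule.smul_mem _ (⟨_, hr⟩ : Subring.center D) hx

theorem Subring.finite_center [FiniteDimensional F D] : Module.Finite (Subring.center D) D := by
  obtain ⟨s, hs⟩ := Module.Finite.fg_top (R := F) (M := D)
  exact ⟨⟨s, Subring.span_center_eq_top hs⟩⟩

theorem Subring.isCentral_center : Algebra.IsCentral (Subring.center D) D := by
  refine ⟨fun x hx ↦ Algebra.mem_bot.2 ⟨⟨x, ?_⟩, rfl⟩⟩
  rw [Subalgebra.mem_center_iff] at hx
  exact Subring.mem_center_iff.2 hx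

theorem Subalgebra.inv_mem_of_finiteDimensional (A : Subalgebra F D) [FiniteDimensional F A]
    {x : D} (hx : x ∈ A) : x⁻¹ ∈ A := by
  rcases eq_or_ne x 0 with rfl | hx0
  · simp
  · have hne : (⟨x, hx⟩ : A) ≠ 0 := fun h ↦ hx0 (congrArg Subtype.val h)
    obtain ⟨y, hy⟩ := (FiniteDimensional.isUnit F hne).exists_right_inv
    have : x * y = 1 := congrArg Subtype.val hy
    rw [← eq_inv_of_mul_eq_one_right this]
    exact y.2

/-- A finite-dimensional subalgebra of a division algebra, as a division subring. -/
def Subalgebra.toSubfieldOfFiniteDimensional (A : Subalgebra F D) [FiniteDimensional F A] :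
    Subfield D :=
  { A.toSubring with inv_mem' := fun _ hx ↦ A.inv_mem_of_finiteDimensional hx }

instance (A : Subalgebra F D) [FiniteDimensional F A] :
    Algebra F A.toSubfieldOfFiniteDimensional :=
  inferInstanceAs (Algebra F A)

instance (A : Subalgebra F D) [FiniteDimensional F A] :
    FiniteDimensional F A.toSubfieldOfFiniteDimensional :=
  inferInstanceAs (FiniteDimensional F A)

end

section

variable {D : Type*} [DivisionRing D]

/-- The centralizer of a subset of a division ring, as a division subring. -/
def Subfield.centralizer' (s : Set D) : Subfield D :=
  { Subring.centralizer s with inv_mem' := fun _ hx ↦ Set.inv_mem_centralizer₀ hx }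

theorem Subfield.isCommutativeSubfield_closure {s : Set D} (hs : ∀ x ∈ s, ∀ y ∈ s, x * y = y * x) :
    IsCommutativeSubfield (Subfield.closure s) := by
  have h1 : Subfield.closure s ≤ Subfield.centralizer' s :=
    Subfield.closure_le.2 fun x hx y hy ↦ hs y hy x hx
  have h2 : Subfield.closure s ≤ Subfield.centralizer' (Subfield.closure s : Set D) :=
    Subfield.closure_le.2 fun x hx y hy ↦ (h1 hy x hx).symm
  exact fun x hx y hy ↦ h2 hy x hx

theorem IsMaximalSubfield.mem_of_commute {K : Subfield D} (hK : IsMaximalSubfield K) {d : D}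
    (hd : ∀ x ∈ K, x * d = d * x) : d ∈ K := by
  have hcomm : IsCommutativeSubfield (Subfield.closure (insert d (K : Set D))) := by
    apply Subfield.isCommutativeSubfield_closure
    rintro x (rfl | hx) y (rfl | hy)
    · rfl
    · exact (hd y hy).symm
    · exact hd x hx
    · exact hK.prop x hx y hy
  exact hK.le_of_ge hcomm (fun x hx ↦ Subfield.subset_closure (Or.inr hx))
    (Subfield.subset_closure (Or.inl rfl))

/-- The inclusion of unit groups of a division subring. -/
abbrev Subfield.unitsMap (E : Subfield D) : Eˣ →* Dˣ := Units.map (E.subtype : E →* D)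

theorem Subfield.mem_range_unitsMap {E : Subfield D} {u : Dˣ} (hu : (u : D) ∈ E) :
    u ∈ E.unitsMap.range :=
  ⟨Units.mk0 ⟨u, hu⟩ fun h ↦ u.ne_zero (congrArg Subtype.val h), Units.ext rfl⟩

theorem Subfield.unitsMap_injective (E : Subfield D) : Function.Injective E.unitsMap :=
  Units.map_injective E.subtype_injective

theorem Subfield.fg_comap_unitsMap {E : Subfield D} {N : Subgroup Dˣ} (hN : N.FG)
    (hNE : N ≤ E.unitsMap.range) : (N.comap E.unitsMap).FG := by
  have h1 : (N.comap E.unitsMap).map E.unitsMap = N := Subgroup.map_comap_eq_self hNE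
  have e := (N.comap E.unitsMap).equivMapOfInjective _ E.unitsMap_injective
  rw [h1] at e
  rw [← Group.fg_iff_subgroup_fg] at hN ⊢
  exact Group.fg_of_surjective (f := e.symm.toMonoidHom) e.symm.surjective

end

theorem Algebra.fg_adjoin_of_finite_of_commute {R A : Type*} [CommRing R] [Ring A] [Algebra R A]
    {s : Set A} (hs : s.Finite) (hcomm : ∀ a ∈ s, ∀ b ∈ s, a * b = b * a)
    (hint : ∀ x ∈ s, IsIntegral R x) : Module.Finite R (Algebra.adjoin R s) := by
  have := Algebra.isMulCommutative_adjoin R hcomm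
  let _ : CommRing (Algebra.adjoin R s) :=
    { (inferInstance : Ring (Algebra.adjoin R s)) with mul_comm := this.is_comm.comm }
  have h1 : ((Algebra.adjoin R ((↑) ⁻¹' s : Set (Algebra.adjoin R s)))).toSubmodule.FG := by
    refine fg_adjoin_of_finite (hs.preimage Subtype.val_injective.injOn) fun x hx ↦ ?_
    exact (isIntegral_algHom_iff (Algebra.adjoin R s).val Subtype.val_injective).1 (hint _ hx)
  rw [Algebra.adjoin_adjoin_coe_preimage] at h1
  exact ⟨h1⟩

/-- A version of `mul_comm_of_fg_isSubnormal_of_span_eq_top` without the centrality assumption. -/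
theorem mul_comm_of_fg_isSubnormal_of_span_eq_top' {F D : Type*} [Field F]
    [DivisionRing D] [Algebra F D] [FiniteDimensional F D] {N : Subgroup Dˣ}
    (hN : N.IsSubnormal) (hfg : N.FG)
    (hspan : Submodule.span F ((fun n : Dˣ ↦ (n : D)) '' N) = ⊤) (x y : D) : x * y = y * x := by
  have := Subring.finite_center (F := F) (D := D)
  have := Subring.isCentral_center (D := D)
  exact mul_comm_of_fg_isSubnormal_of_span_eq_top (F := Subring.center D) hN hfg
    (Subring.span_center_eq_top hspan) x y

/-- The `F`-span of `N` is a finite-dimensional division algebra in which `N` remains subnormal and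
finitely generated, so the spanning case applies there. -/
theorem Subgroup.IsSubnormal.commutative_of_fg (F : Type*) {D : Type*} [Field F] [DivisionRing D]
    [Algebra F D] [FiniteDimensional F D] {N : Subgroup Dˣ} (hN : N.IsSubnormal)
    (hfg : N.FG) : ∀ a ∈ N, ∀ b ∈ N, a * b = b * a := by
  let A : Subalgebra F D := Algebra.adjoin F ((fun n : Dˣ ↦ (n : D)) '' N)
  have hA : Subalgebra.toSubmodule A = Submodule.span F ((fun n : Dˣ ↦ (n : D)) '' N) := by
    rw [Algebra.adjoin_eq_span]
    congr 1
    exact congrArg SetLike.coe (Submonoid.closure_eq (N.toSubmonoid.map (Units.coeHom D)))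
  let E : Subfield D := A.toSubfieldOfFiniteDimensional
  have hNE : ∀ n ∈ N, (n : D) ∈ E := fun n hn ↦ Algebra.subset_adjoin ⟨n, hn, rfl⟩
  have hrange : N ≤ E.unitsMap.range := fun n hn ↦ Subfield.mem_range_unitsMap (hNE n hn)
  have hspan : Submodule.span F ((fun n : Eˣ ↦ (n : E)) '' (N.comap E.unitsMap)) = ⊤ := by
    rw [eq_top_iff]
    rintro ⟨x, hx⟩ -
    have hx' : x ∈ Submodule.span F ((fun n : Dˣ ↦ (n : D)) '' N) := hA ▸ hx
    let f : E →ₗ[F] D :=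
      { toFun := Subtype.val, map_add' := fun _ _ ↦ rfl, map_smul' := fun _ _ ↦ rfl }
    have himage : (fun n : Dˣ ↦ (n : D)) '' N ⊆
        f '' ((fun n : Eˣ ↦ (n : E)) '' (N.comap E.unitsMap)) := by
      rintro _ ⟨n, hn, rfl⟩
      obtain ⟨n', rfl⟩ := hrange hn
      exact ⟨n', ⟨n', hn, rfl⟩, rfl⟩
    have hmap := Submodule.span_mono (R := F) himage hx'
    rw [← Submodule.map_span] at hmap
    obtain ⟨y, hy, hyx⟩ := hmap
    obtain rfl : y = ⟨x, hx⟩ := Subtype.ext hyx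
    exact hy
  intro a ha b hb
  have := mul_comm_of_fg_isSubnormal_of_span_eq_top' (hN.comap E.unitsMap)
    (Subfield.fg_comap_unitsMap hfg hrange) hspan ⟨a, hNE a ha⟩ ⟨b, hNE b hb⟩
  exact Units.ext (congrArg Subtype.val this)

/-- Finitely generated subnormal subgroups of the unit group of a finite-dimensional division
algebra are central. -/
theorem Subgroup.IsSubnormal.commute_of_fg (F : Type*) {D : Type*} [Field F] [DivisionRing D]
    [Algebra F D] [FiniteDimensional F D] {N : Subgroup Dˣ} (hN : N.IsSubnormal)
    (hfg : N.FG) {a : Dˣ} (ha : a ∈ N) (y : D) : y * a = a * y :=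
  hN.commute_of_commutative (F := F) (hN.commutative_of_fg F hfg) ha y

/-! ### Reduction from the strongly algebraic case. -/

/-- Since `T` is central in its centralizer `E`, adjoining `S \ T` to the center of `E` recovers all
of `K`. An element of `E` centralizing this algebra centralizes `K`, so it lies in `K` by
maximality. -/
theorem IsMaximalSubfield.finite_center_centralizer {D : Type*} [DivisionRing D] {K : Subfield D}
    (hK : IsMaximalSubfield K) {S T : Set D}
    (hKS : K = Subfield.closure ((Subring.center D : Set D) ∪ S)) (hT : T ⊆ S)
    (hfin : (S \ T).Finite) (hint : ∀ x ∈ S \ T, IsIntegral (Subring.center D) x) :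
    Module.Finite (Subring.center (Subfield.centralizer' T)) (Subfield.centralizer' T) := by
  set E := Subfield.centralizer' T with hE
  set Z := Subring.center E with hZ
  have hSK : S ⊆ K := fun x hx ↦ hKS ▸ Subfield.subset_closure (Or.inr hx)
  have hKE : K ≤ E := fun x hx y hy ↦ hK.prop y (hSK (hT hy)) x hx
  have hFE : ∀ x ∈ Subring.center D, x ∈ E := fun x hx y _ ↦ Subring.mem_center_iff.1 hx y
  let φ : Subring.center D →+* Z :=
    { toFun := fun x ↦ ⟨⟨x, hFE x x.2⟩, Subring.mem_center_iff.2 fun y ↦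
        Subtype.ext (Subring.mem_center_iff.1 x.2 y)⟩
      map_one' := rfl
      map_mul' := fun _ _ ↦ rfl
      map_zero' := rfl
      map_add' := fun _ _ ↦ rfl }
  let s : Set E := Subtype.val ⁻¹' (S \ T)
  have hs : s.Finite := hfin.preimage Subtype.val_injective.injOn
  have hscomm : ∀ a ∈ s, ∀ b ∈ s, a * b = b * a := fun a ha b hb ↦
    Subtype.ext (hK.prop a (hSK ha.1) b (hSK hb.1))
  have hsint : ∀ x ∈ s, IsIntegral Z x := by
    intro x hx
    obtain ⟨p, hp, hpx⟩ := hint x hx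
    refine ⟨p.map φ, hp.map φ, ?_⟩
    apply E.subtype_injective
    rw [Polynomial.eval₂_map, Polynomial.hom_eval₂, map_zero]
    exact hpx
  let A : Subalgebra Z E := Algebra.adjoin Z s
  have : FiniteDimensional Z A := Algebra.fg_adjoin_of_finite_of_commute hs hscomm hsint
  refine A.finiteDimensional_of_centralizer_le fun d hd ↦ ?_
  rw [Subalgebra.mem_centralizer_iff] at hd
  have hdK : (d : D) ∈ K := by
    refine hK.mem_of_commute fun x hx ↦ ?_
    have hle : K ≤ Subfield.centralizer' {(d : D)} := by
      rw [hKS, Subfield.closure_le]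
      rintro y (hy | hy) z hz
      · exact Subring.mem_center_iff.1 hy z
      · obtain rfl := hz
        by_cases hyT : y ∈ T
        · exact (d.2 y hyT).symm
        · exact (congrArg Subtype.val
            (hd ⟨y, hKE (hSK hy)⟩ (Algebra.subset_adjoin ⟨hy, hyT⟩))).symm
    exact (hle hx d rfl).symm
  have hKA : K ≤ A.toSubfieldOfFiniteDimensional.map E.subtype := by
    rw [hKS, Subfield.closure_le]
    rintro y (hy | hy)
    · exact ⟨⟨y, hFE y hy⟩, A.algebraMap_mem (φ ⟨y, hy⟩), rfl⟩
    · refine ⟨⟨y, hKE (hSK hy)⟩, ?_, rfl⟩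
      by_cases hyT : y ∈ T
      · exact A.algebraMap_mem (⟨⟨y, hKE (hSK hy)⟩, Subring.mem_center_iff.2 fun z ↦
          Subtype.ext (z.2 y hyT).symm⟩ : Z)
      · exact Algebra.subset_adjoin ⟨hy, hyT⟩
  obtain ⟨d', hd', hdd'⟩ := hKA hdK
  obtain rfl : d' = d := Subtype.ext hdd'
  exact hd'

theorem theorem4p1 {D : Type*} [DivisionRing D] (hD : IsStronglyAlgebraic D)
    (N : Subgroup Dˣ) (hN : N.IsSubnormal) (hfg : N.FG) :
    ∀ u ∈ N, (u : D) ∈ Subring.center D := by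
  intro u hu
  rw [Subring.mem_center_iff]
  intro b
  obtain ⟨K, hK, S, hSK, hKS, hfin⟩ := hD.exists_maximalSubfield
  have halg := hD.algebraic
  obtain ⟨G, hG⟩ := id hfg
  -- Including `b` places it in the same centralizer as `N`, where centrality of `N` gives the
  -- required commutation.
  let X : Set D := insert b ((fun n : Dˣ ↦ (n : D)) '' G)
  have hX : X.Finite := (G.finite_toSet.image _).insert b
  let T : Set D := {y ∈ S | ∀ x ∈ X, x * y = y * x}
  have hST : (S \ T).Finite := by
    refine (hX.biUnion fun x _ ↦ hfin x).subset ?_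
    rintro y ⟨hyS, hyT⟩
    have : ∃ x ∈ X, x * y ≠ y * x := by
      by_contra! hcon
      exact hyT ⟨hyS, hcon⟩
    obtain ⟨x, hx, hxy⟩ := this
    exact Set.mem_biUnion hx ⟨hyS, hxy⟩
  have := hK.finite_center_centralizer hKS (fun y hy ↦ hy.1) hST
    (fun x _ ↦ (halg.isAlgebraic x).isIntegral)
  have hXE : ∀ x ∈ X, x ∈ Subfield.centralizer' T := fun x hx y hy ↦ (hy.2 x hx).symm
  have hrange : N ≤ (Subfield.centralizer' T).unitsMap.range := by
    rw [← hG, Subgroup.closure_le]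
    exact fun n hn ↦ Subfield.mem_range_unitsMap (hXE _ (Or.inr ⟨n, hn, rfl⟩))
  obtain ⟨u', rfl⟩ := hrange hu
  have := (hN.comap (Subfield.centralizer' T).unitsMap).commute_of_fg
    (Subring.center (Subfield.centralizer' T)) (Subfield.fg_comap_unitsMap hfg hrange) hu
    ⟨b, hXE b (Or.inl rfl)⟩
  exact congrArg Subtype.val this
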